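/- Let $k$ be a field of characteristic zero and let $q,r\ge 2$ be coprime integers. Let $m\ge 0$ be an integer, let $\underline{n}=(n_0,\ldots,n_m)$ be a tuple of integers $n_i>1$, and let $p\in k[u]$ be a polynomial with $p(0)\neq 0$. Put $$R_m(\underline{n},p)=k[x_0,\ldots,x_m,y,z,t]\Big/\Big(\big(\textstyle\prod_{i=0}^m x_i^{n_i}\big)\,y+z^q+t^r+x_0\,p\big(\textstyle\prod_{i=0}^m x_i\big)\Big)$$ and $X_m(\underline n,p)=\mathrm{Spec}\,R_m(\underline n,p)$. For a $k$-algebra $A$, a $k$-derivation $D$ of $A$ is called locally nilpotent if for every $a\in A$ there is $s\ge 0$ with $D^s(a)=0$. The Makar-Limanov invariant $\mathrm{ML}(A)$ is the intersection of the kernels of all locally nilpotent $k$-derivations of $A$, and the Derksen invariant $\mathrm{DK}(A)$ is the $k$-subalgebra of $A$ generated by the kernels of all nonzero locally nilpotent $k$-derivations of $A$. Then the polynomial ring $R_m(\underline{n},p)[w]$ in one variable over $R_m(\underline n,p)$ satisfies $$\mathrm{ML}\big(R_m(\underline{n},p)[w]\big)=k\quad\text{and}\quad \mathrm{DK}\big(R_m(\underline{n},p)[w]\big)=R_m(\underline{n},p)[w].$$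 The polynomial ring $B=k[u_1,\ldots,u_{m+4}]$ likewise satisfies $\mathrm{ML}(B)=k$ and $\mathrm{DK}(B)=B$, so these two invariants do not distinguish $X_m(\underline{n},p)\times_k\mathbb{A}^1_k$ from the affine space $\mathbb{A}^{m+4}_k$. -/

import Mathlib

/-- A `k`-derivation `D` of `A` is locally nilpotent if every element of `A` is killed by some
iterate of `D`. -/
def IsLocallyNilpotentDerivation {k A : Type*} [CommRing k] [CommRing A] [Algebra k A]
    (D : Derivation k A A) : Prop :=
  ∀ a : A, ∃ n : ℕ, D^[n] a = 0

/-- The kernel of a `k`-derivation of `A`, as a `k`-subalgebra of `A`. -/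
def derivationKer {k A : Type*} [CommRing k] [CommRing A] [Algebra k A]
    (D : Derivation k A A) : Subalgebra k A where
  carrier := {a | D a = 0}
  mul_mem' := by
    intro a b ha hb
    simp only [Set.mem_ofPred_eq] at ha hb ⊢
    simp [ha, hb]
  add_mem' := by
    intro a b ha hb
    simp only [Set.mem_ofPred_eq] at ha hb ⊢
    simp [ha, hb]
  algebraMap_mem' := fun c => D.map_algebraMap c

/-- The Makar-Limanov invariant: the intersection of the kernels of all locally nilpotent
`k`-derivations of `A`. -/
def makarLimanov (k A : Type*) [CommRing k] [CommRing A] [Algebra k A] : Subalgebra k A :=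
  ⨅ (D : Derivation k A A) (_ : IsLocallyNilpotentDerivation D), derivationKer D

/-- The Derksen invariant: the `k`-subalgebra of `A` generated by the kernels of all nonzero
locally nilpotent `k`-derivations of `A`. -/
def derksen (k A : Type*) [CommRing k] [CommRing A] [Algebra k A] : Subalgebra k A :=
  Algebra.adjoin k
    {a : A | ∃ D : Derivation k A A, IsLocallyNilpotentDerivation D ∧ D ≠ 0 ∧ D a = 0}

/-- The variables `x_0, …, x_m` and `y, z, t`. -/
inductive KRVar (m : ℕ) : Type
  | x (i : Fin (m + 1)) : KRVar m
  | y : KRVar m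
  | z : KRVar m
  | t : KRVar m

/-- The polynomial `(∏ x_i ^ n_i) y + z ^ q + t ^ r + x_0 p(∏ x_i)` in
`k[x_0, …, x_m, y, z, t]`. -/
noncomputable def krPoly (k : Type*) [Field k] (q r m : ℕ) (n : Fin (m + 1) → ℕ)
    (p : Polynomial k) : MvPolynomial (KRVar m) k :=
  (∏ i, MvPolynomial.X (KRVar.x i) ^ n i) * MvPolynomial.X KRVar.y
    + MvPolynomial.X KRVar.z ^ q + MvPolynomial.X KRVar.t ^ r
    + MvPolynomial.X (KRVar.x 0) * Polynomial.aeval (∏ i, MvPolynomial.X (KRVar.x i)) p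

/-- The `k`-algebra `R_m(n, p)`, the quotient of `k[x_0, …, x_m, y, z, t]` by the ideal generated
by `krPoly`. -/
abbrev KRAlgebra (k : Type*) [Field k] (q r m : ℕ) (n : Fin (m + 1) → ℕ)
    (p : Polynomial k) : Type _ :=
  MvPolynomial (KRVar m) k ⧸ Ideal.span {krPoly k q r m n p}

/-!
Write `R` for the algebra and `B = R[w]`. The derivation `∂/∂w` has kernel `R`, and the Jacobian
derivation of `R` in the variables `y, z`, extended to `B` coefficientwise, kills `w`; so the
Derksen invariant of `B` is everything (`derksen_cylinder`).

For the Makar-Limanov invariant, `∂/∂w` and the Jacobian derivations in `y, z` and `y, t` reduce an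
element of the invariant to a Laurent polynomial in `x_0, …, x_m`. It remains to find, for every
`i`, a locally nilpotent derivation of `B` that moves `ξ = x_i` and kills the other `x_j`. Let
`P = k[t, x_j (j ≠ i)]`. The defining equation can be written `c ξ ^ n y + z ^ q + τ + ξ h = 0` with
nonzero `c, τ ∈ P` and `h ∈ P[ξ]`. Put `Z = z + ξ w` and `v = -(Z ^ q + τ) / ξ`, which lies in `B`.
The hypersurface `ξ v + Z ^ q + τ = 0` carries the locally nilpotent derivation
`Z ↦ v`, `ξ ↦ -q Z ^ (q - 1)`, `v ↦ 0`, and the point is that this derivation lifts to `B` up to a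
factor in `P` (`exists_locallyNilpotent_smul_add_smul`): over the fraction field `K` of `P`, the
element `Z` is a unit modulo `ξ`, so Hensel's lemma gives `ω ∈ K[ξ, Z, v]` with
`(Z - ξ ω) ^ q + τ + ξ h ∈ (ξ ^ n)`, and then `s = (w - ω) / ξ ^ (n - 1)` satisfies
`K ⊗ B = K[ξ, Z, v, s]`. Prescribing `s ↦ 0` gives a locally nilpotent derivation of `K ⊗ B`, and
clearing denominators by an element of `P`, which it kills, gives one of `B`.

These derivations act on `k[x_0, …, x_m]` as nonzero multiples of the `∂/∂x_i`. If
`(∏ x_i ^ n_i) ^ N a = g` with `a` in the invariant and `g` a polynomial, then `g` has the same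
logarithmic derivatives as the monomial `(∏ x_i ^ n_i) ^ N`, hence is a constant multiple of it
(`eq_monomial_of_mul_pderiv_eq`), and `a` is constant.
-/

/-! ### Hensel's lemma modulo powers of an element -/

open Polynomial in
/-- Hensel lifting: a root of `F` modulo `ξ` at which the derivative is a unit modulo `ξ` lifts to a
root modulo any power of `ξ`. No completeness or nilpotence is assumed. -/
theorem exists_pow_dvd_eval_of_isCoprime {T : Type*} [CommRing T] (F : T[X]) (ξ Z : T)
    (h0 : ξ ∣ F.eval Z) (hc : IsCoprime ξ (F.derivative.eval Z)) (N : ℕ) :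
    ∃ Z', ξ ∣ Z' - Z ∧ ξ ^ (N + 1) ∣ F.eval Z' := by
  obtain ⟨u, e, he⟩ := hc
  induction N with
  | zero => exact ⟨Z, by simp, by simpa using h0⟩
  | succ N ih =>
    obtain ⟨Z', ⟨d, hd⟩, ⟨f, hf⟩⟩ := ih
    obtain ⟨r, hr⟩ := F.binomExpansion Z' (-(e * ξ ^ (N + 1) * f))
    obtain ⟨a, ha⟩ : ξ ∣ F.derivative.eval Z' - F.derivative.eval Z :=
      (Dvd.intro _ hd.symm).trans (Polynomial.sub_dvd_eval_sub _ _ _)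
    refine ⟨Z' + -(e * ξ ^ (N + 1) * f), ⟨d - e * ξ ^ N * f, by linear_combination hd⟩,
      ⟨u * f - e * a * f + r * e ^ 2 * ξ ^ N * f ^ 2, ?_⟩⟩
    rw [hr, hf]
    linear_combination (-(e * ξ ^ (N + 1) * f)) * ha - (ξ ^ (N + 1) * f) * he

/-- If `a` and `b` are congruent to `Z` modulo `ξ`, then `(a ^ q - b ^ q) / (a - b)` is congruent to
`q Z ^ (q - 1)`, hence a unit modulo `ξ ^ n` as soon as the latter is a unit modulo `ξ`. -/
theorem isCoprime_pow_geom_sum₂ {T : Type*} [CommRing T] {ξ Z a b : T} {q : ℕ} (n : ℕ)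
    (ha : ξ ∣ a - Z) (hb : ξ ∣ b - Z) (h : IsCoprime ξ (q * Z ^ (q - 1))) :
    IsCoprime (ξ ^ n) (∑ i ∈ Finset.range q, a ^ i * b ^ (q - 1 - i)) := by
  refine IsCoprime.pow_left ?_
  obtain ⟨d, hd⟩ : ξ ∣ (∑ i ∈ Finset.range q, a ^ i * b ^ (q - 1 - i)) - q * Z ^ (q - 1) := by
    rw [← Ideal.mem_span_singleton, ← Ideal.Quotient.eq] at *
    rw [map_sum, map_mul, map_natCast, map_pow]
    simp only [map_mul, map_pow, ha, hb, ← pow_add]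
    rw [Finset.sum_congr rfl (g := fun _ => (Ideal.Quotient.mk (Ideal.span {ξ}) Z) ^ (q - 1))]
    · simp
    · intro i hi
      rw [Finset.mem_range] at hi
      congr 1
      omega
  rw [show (∑ i ∈ Finset.range q, a ^ i * b ^ (q - 1 - i)) = q * Z ^ (q - 1) + ξ * d by
    rw [← hd]; ring]
  exact IsCoprime.add_mul_left_right h d

/-! ### Locally nilpotent elements of a derivation -/

section
variable {k A : Type*} [CommRing k] [CommRing A] [Algebra k A]

/-- The elements killed by some iterate of a derivation; they form a subalgebra by the Leibniz rule,
so local nilpotency can be tested on generators. -/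
def nilSubalgebra (D : Derivation k A A) : Subalgebra k A where
  carrier := {a | ∃ n : ℕ, D^[n] a = 0}
  mul_mem' := by
    -- `D (a b)` is a sum of two products with smaller total nilpotency order
    have key : ∀ N m n : ℕ, m + n = N → ∀ a b : A, D^[m] a = 0 → D^[n] b = 0 →
        D^[m + n] (a * b) = 0 := by
      intro N
      induction N with
      | zero =>
        intro m n h a b ha _
        obtain ⟨rfl, rfl⟩ : m = 0 ∧ n = 0 := by omega
        simp_all
      | succ N ih =>
        intro m n h a b ha hb
        rcases m with _ | m
        · have : a = 0 := ha
          rw [this, zero_mul, iterate_map_zero]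
        rcases n with _ | n
        · have : b = 0 := hb
          rw [this, mul_zero, iterate_map_zero]
        rw [show m + 1 + (n + 1) = (m + 1 + n) + 1 by omega, Function.iterate_succ_apply,
          D.leibniz, iterate_map_add, smul_eq_mul, smul_eq_mul, ih (m + 1) n (by omega) a _ ha hb,
          show m + 1 + n = (n + 1) + m by omega, ih (n + 1) m (by omega) b _ hb ha, add_zero]
    rintro a b ⟨m, hm⟩ ⟨n, hn⟩
    exact ⟨m + n, key _ m n rfl a b hm hn⟩
  add_mem' := by
    rintro a b ⟨m, hm⟩ ⟨n, hn⟩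
    refine ⟨m + n, ?_⟩
    rw [iterate_map_add, add_comm m n, Function.iterate_add_apply, hm, add_comm n m,
      Function.iterate_add_apply, hn, iterate_map_zero, iterate_map_zero, add_zero]
  algebraMap_mem' := fun c => ⟨1, D.map_algebraMap c⟩

theorem mem_nilSubalgebra_of_apply_mem {D : Derivation k A A} {a : A}
    (h : D a ∈ nilSubalgebra D) : a ∈ nilSubalgebra D := by
  obtain ⟨n, hn⟩ := h
  exact ⟨n + 1, hn⟩

theorem mem_nilSubalgebra_of_apply_eq_zero {D : Derivation k A A} {a : A} (h : D a = 0) :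
    a ∈ nilSubalgebra D := ⟨1, h⟩

theorem iterate_smul_apply {D : Derivation k A A} {g : A} (hg : D g = 0) (n : ℕ) (a : A) :
    (g • D)^[n] a = g ^ n * D^[n] a := by
  induction n with
  | zero => simp
  | succ n ih =>
    rw [Function.iterate_succ_apply', ih, Function.iterate_succ_apply', Derivation.smul_apply,
      D.leibniz, D.leibniz_pow, hg]
    simp only [smul_eq_mul]
    ring_nf

theorem derivation_mapsTo_adjoin {D : Derivation k A A} {s : Set A} {T : Subalgebra k A}
    (hT : Algebra.adjoin k s ≤ T) (h : ∀ a ∈ s, D a ∈ T) {a : A} (ha : a ∈ Algebra.adjoin k s) :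
    D a ∈ T := by
  induction ha using Algebra.adjoin_induction with
  | mem x hx => exact h x hx
  | algebraMap r => rw [D.map_algebraMap]; exact T.zero_mem
  | add x y _ _ hx hy => rw [map_add]; exact T.add_mem hx hy
  | mul x y hx' hy' hx hy =>
    rw [D.leibniz]
    exact T.add_mem (T.mul_mem (hT hx') hy) (T.mul_mem (hT hy') hx)

end

/-! ### Localization inside a field -/

section
variable {k L : Type*} [CommRing k] [Field L] [Algebra k L]

/-- The localization of a subalgebra `S` of a field at the nonzero elements of a subalgebra
`P ≤ S`, realized inside the field. -/
def locSubalgebra (P S : Subalgebra k L) (hPS : P ≤ S) : Subalgebra k L where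
  carrier := {f | ∃ g ∈ P, g ≠ 0 ∧ g * f ∈ S}
  mul_mem' := by
    rintro a b ⟨g, hg, hg0, hga⟩ ⟨g', hg', hg0', hgb⟩
    refine ⟨g * g', P.mul_mem hg hg', mul_ne_zero hg0 hg0', ?_⟩
    rw [mul_mul_mul_comm]
    exact S.mul_mem hga hgb
  add_mem' := by
    rintro a b ⟨g, hg, hg0, hga⟩ ⟨g', hg', hg0', hgb⟩
    refine ⟨g * g', P.mul_mem hg hg', mul_ne_zero hg0 hg0', ?_⟩
    rw [show g * g' * (a + b) = g' * (g * a) + g * (g' * b) by ring]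
    exact S.add_mem (S.mul_mem (hPS hg') hga) (S.mul_mem (hPS hg) hgb)
  algebraMap_mem' := fun c => ⟨1, P.one_mem, one_ne_zero, by
    rw [one_mul]; exact S.algebraMap_mem c⟩

theorem le_locSubalgebra {P S : Subalgebra k L} (hPS : P ≤ S) : S ≤ locSubalgebra P S hPS :=
  fun f hf => ⟨1, P.one_mem, one_ne_zero, by rwa [one_mul]⟩

theorem inv_mem_locSubalgebra {P S : Subalgebra k L} (hPS : P ≤ S) {p : L} (hp : p ∈ P) :
    p⁻¹ ∈ locSubalgebra P S hPS := by
  by_cases h : p = 0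
  · rw [h, inv_zero]; exact Subalgebra.zero_mem _
  · exact ⟨p, hp, h, by rw [mul_inv_cancel₀ h]; exact S.one_mem⟩

end

/-! ### Lifting a locally nilpotent derivation to the cylinder -/

/-- Let `S` be the `P`-algebra generated inside a field by `ξ, y, z, w`, subject to
`c ξ ^ n y + z ^ q + τ + ξ h = 0`. A derivation `E₀` of the field inducing `Z ↦ v`,
`ξ ↦ -q Z ^ (q - 1)` on the hypersurface `ξ v + Z ^ q + τ = 0`, where `Z = z + ξ w`, becomes a
locally nilpotent derivation of `S` after adding a multiple of `Δ` and then multiplying by some `g ≠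
0`. Here `Δ` is a derivation that kills `P`, `ξ`, `Z` and moves `w`, so that adding multiples of it
changes only the lift and not the induced derivation. -/
theorem exists_locallyNilpotent_smul_add_smul {k L : Type*} [Field k] [CharZero k] [Field L]
    [Algebra k L] {P S : Subalgebra k L} {E₀ Δ : Derivation k L L} {ξ y z w τ c h v : L}
    {n q : ℕ} (hE₀P : ∀ p ∈ P, E₀ p = 0) (hΔP : ∀ p ∈ P, Δ p = 0) (hn : n ≠ 0) (hq : q ≠ 0)
    (hτP : τ ∈ P) (hτ : τ ≠ 0) (hcP : c ∈ P) (hc : c ≠ 0)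
    (hh : h ∈ Algebra.adjoin k (insert ξ (P : Set L))) (hξ : ξ ≠ 0)
    (hS : S = Algebra.adjoin k ((P : Set L) ∪ {ξ, y, z, w}))
    (rel : c * ξ ^ n * y + z ^ q + τ + ξ * h = 0)
    (hv : ξ * v + (z + ξ * w) ^ q + τ = 0)
    (hE₀ξ : E₀ ξ = -(q * (z + ξ * w) ^ (q - 1))) (hE₀Z : E₀ (z + ξ * w) = v)
    (hΔξ : Δ ξ = 0) (hΔz : Δ z = -ξ) (hΔw : Δ w = 1) :
    ∃ b g : L, g ≠ 0 ∧ ∀ f ∈ S, (g • (E₀ + b • Δ)) f ∈ S ∧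
      ∃ N : ℕ, (g • (E₀ + b • Δ))^[N] f = 0 := by
  have : CharZero L := charZero_of_injective_algebraMap (algebraMap k L).injective
  set Z := z + ξ * w with hZ
  have hqk : (q : k) ≠ 0 := Nat.cast_ne_zero.mpr hq
  have hqL : (q : L) ≠ 0 := Nat.cast_ne_zero.mpr hq
  have hPS : P ≤ S := by
    rw [hS]
    exact fun p hp => Algebra.subset_adjoin (Or.inl hp)
  have hξS : ξ ∈ S := by rw [hS]; exact Algebra.subset_adjoin (Or.inr (by simp))
  have hyS : y ∈ S := by rw [hS]; exact Algebra.subset_adjoin (Or.inr (by simp))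
  have hzS : z ∈ S := by rw [hS]; exact Algebra.subset_adjoin (Or.inr (by simp))
  have hwS : w ∈ S := by rw [hS]; exact Algebra.subset_adjoin (Or.inr (by simp))
  set B := locSubalgebra P S hPS with hB
  have hSB : S ≤ B := le_locSubalgebra hPS
  have hhS : h ∈ S := by
    refine Algebra.adjoin_le ?_ hh
    rintro a (rfl | ha)
    exacts [hξS, hPS ha]
  have hZS : Z ∈ S := S.add_mem hzS (S.mul_mem hξS hwS)
  -- `v` is a polynomial in the generators of `S`, since `Z ^ q - z ^ q` is divisible by `ξ`
  have hvS : v ∈ S := by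
    have h1 : v = c * ξ ^ (n - 1) * y + h -
        w * ∑ i ∈ Finset.range q, Z ^ i * z ^ (q - 1 - i) := by
      refine mul_left_cancel₀ hξ ?_
      obtain ⟨n, rfl⟩ := Nat.exists_eq_succ_of_ne_zero hn
      have := geom_sum₂_mul Z z q
      rw [Nat.succ_eq_add_one, Nat.add_sub_cancel]
      rw [Nat.succ_eq_add_one] at rel
      rw [show Z - z = ξ * w by rw [hZ]; ring] at this
      linear_combination hv - rel + this
    rw [h1]
    refine S.sub_mem (S.add_mem (S.mul_mem (S.mul_mem (hPS hcP) (S.pow_mem hξS _)) hyS) hhS)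
      (S.mul_mem hwS (S.sum_mem fun i _ => S.mul_mem (S.pow_mem hZS _) (S.pow_mem hzS _)))
  -- `K` generates the fraction field of `P`, and `T₁` is `Frac(P)[ξ, Z, v]`
  set K : Set L := (P : Set L) ∪ {a | a⁻¹ ∈ P} with hK
  set T₁ : Subalgebra k L := Algebra.adjoin k (K ∪ {ξ, Z, v}) with hT₁
  have hPT₁ : P ≤ T₁ := fun p hp => Algebra.subset_adjoin (Or.inl (Or.inl hp))
  have hiT₁ : ∀ p ∈ P, p⁻¹ ∈ T₁ := fun p hp =>
    Algebra.subset_adjoin (Or.inl (Or.inr (by simpa using hp)))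
  have hξT₁ : ξ ∈ T₁ := Algebra.subset_adjoin (Or.inr (by simp))
  have hZT₁ : Z ∈ T₁ := Algebra.subset_adjoin (Or.inr (by simp))
  have hvT₁ : v ∈ T₁ := Algebra.subset_adjoin (Or.inr (by simp))
  have hhT₁ : h ∈ T₁ := by
    refine Algebra.adjoin_le ?_ hh
    rintro a (rfl | ha)
    exacts [hξT₁, hPT₁ ha]
  have hKB : K ⊆ B := by
    rintro a (ha | ha)
    · exact hSB (hPS ha)
    · simpa using inv_mem_locSubalgebra hPS ha
  have hT₁B : T₁ ≤ B := by
    refine Algebra.adjoin_le (Set.union_subset hKB ?_)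
    rintro a (rfl | rfl | rfl)
    exacts [hSB hξS, hSB hZS, hSB hvS]
  -- `Z` is a unit modulo `ξ`, because `Z ^ q = -τ - ξ v`
  have hcop : ∀ (T : Subalgebra k L) (hT : T₁ ≤ T), IsCoprime (⟨ξ, hT hξT₁⟩ : T)
      (q * ⟨Z, hT hZT₁⟩ ^ (q - 1)) := by
    intro T hT
    refine ⟨⟨-v * τ⁻¹, hT (T₁.mul_mem (T₁.neg_mem hvT₁) (hiT₁ τ hτP))⟩,
      ⟨-Z * τ⁻¹ * algebraMap k L (q : k)⁻¹, hT (T₁.mul_mem (T₁.mul_mem (T₁.neg_mem hZT₁)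
        (hiT₁ τ hτP)) (T₁.algebraMap_mem _))⟩, Subtype.ext ?_⟩
    have : Z * Z ^ (q - 1) = Z ^ q := mul_pow_sub_one hq Z
    have hqT : ((q : T) : L) = q := map_natCast T.val q
    simp only [Subalgebra.coe_add, Subalgebra.coe_mul, Subalgebra.coe_pow, Subalgebra.coe_one,
      hqT, map_inv₀, map_natCast]
    field_simp
    linear_combination -this - hv
  obtain ⟨ω, hωT₁, f, hfT₁, hf⟩ : ∃ ω ∈ T₁, ∃ f ∈ T₁, (Z - ξ * ω) ^ q + τ + ξ * h = ξ ^ n * f := by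
    obtain ⟨⟨Z', hZ'⟩, ⟨⟨d, hd⟩, hd'⟩, ⟨⟨f, hf⟩, hf'⟩⟩ := exists_pow_dvd_eval_of_isCoprime
      (Polynomial.X ^ q + Polynomial.C (⟨τ + ξ * h, T₁.add_mem (hPT₁ hτP) (T₁.mul_mem hξT₁ hhT₁)⟩ :
        T₁)) (⟨ξ, hξT₁⟩ : T₁) ⟨Z, hZT₁⟩
      ⟨⟨h - v, T₁.sub_mem hhT₁ hvT₁⟩, by
        refine Subtype.ext ?_
        simp only [Polynomial.eval_add, Polynomial.eval_pow, Polynomial.eval_X, Polynomial.eval_C,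
          Subalgebra.coe_add, Subalgebra.coe_mul, Subalgebra.coe_pow]
        linear_combination hv⟩ (by
        simpa only [Polynomial.derivative_add, Polynomial.derivative_X_pow, Polynomial.derivative_C,
          add_zero, Polynomial.eval_mul, Polynomial.eval_C, Polynomial.eval_pow, Polynomial.eval_X,
          Polynomial.C_eq_natCast, Polynomial.eval_natCast] using hcop T₁ le_rfl) (n - 1)
    refine ⟨-d, T₁.neg_mem hd, f, hf, ?_⟩
    have h1 := congrArg Subtype.val hd'
    have h2 := congrArg Subtype.val hf'
    simp only [Polynomial.eval_add, Polynomial.eval_pow, Polynomial.eval_X, Polynomial.eval_C,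
      Subalgebra.coe_add, Subalgebra.coe_mul, Subalgebra.coe_pow, Subalgebra.coe_sub,
      Nat.sub_add_cancel (Nat.pos_of_ne_zero hn)] at h1 h2
    rw [← h2, show Z - ξ * -d = Z' by linear_combination -h1]
    ring
  set s := (w - ω) / ξ ^ (n - 1) with hs
  have hws : w = ω + ξ ^ (n - 1) * s := by
    rw [hs]; field_simp; ring
  have hξn : ξ * ξ ^ (n - 1) = ξ ^ n := mul_pow_sub_one hn ξ
  -- the slice relation `z = (Z - ξ ω) - ξ ^ n s`
  have hzs : Z - ξ * ω - z = ξ ^ n * s := by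
    linear_combination hZ + ξ * hws + s * hξn
  set G := ∑ i ∈ Finset.range q, (Z - ξ * ω) ^ i * z ^ (q - 1 - i) with hG
  have hGs : s * G = f + c * y := by
    refine mul_left_cancel₀ (pow_ne_zero n hξ) ?_
    have := geom_sum₂_mul (Z - ξ * ω) z q
    rw [← hG, hzs] at this
    linear_combination this + hf - rel
  have hωB : ω ∈ B := hT₁B hωT₁
  have hsB : s ∈ B := by
    obtain ⟨⟨e', he'⟩, ⟨e, he⟩, hee⟩ := isCoprime_pow_geom_sum₂ (T := B) (ξ := ⟨ξ, hSB hξS⟩)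
      (Z := ⟨Z, hSB hZS⟩)
      (a := ⟨Z - ξ * ω, B.sub_mem (hSB hZS) (B.mul_mem (hSB hξS) hωB)⟩)
      (b := ⟨z, hSB hzS⟩) (q := q) n
      ⟨⟨-ω, B.neg_mem hωB⟩, Subtype.ext (by simp)⟩
      ⟨⟨-w, B.neg_mem (hSB hwS)⟩, Subtype.ext (by simp [hZ])⟩ (hcop B hT₁B)
    have h1 := congrArg Subtype.val hee
    simp only [Subalgebra.coe_add, Subalgebra.coe_mul, Subalgebra.coe_pow, Subalgebra.coe_one,
      AddSubmonoidClass.coe_finsetSum, ← hG] at h1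
    have h2 : s = e' * (Z - ξ * ω - z) + e * (f + c * y) := by
      rw [hzs]
      linear_combination (-s) * h1 + e * hGs
    rw [h2]
    exact B.add_mem (B.mul_mem he' (B.sub_mem (B.sub_mem (hSB hZS) (B.mul_mem (hSB hξS) hωB))
      (hSB hzS))) (B.mul_mem he (B.add_mem (hT₁B hfT₁) (B.mul_mem (hSB (hPS hcP)) (hSB hyS))))
  -- `T₂` is `Frac(P)[ξ, Z, v, s]`; it turns out to be the localization `B` of `S`
  set T₂ : Subalgebra k L := Algebra.adjoin k ((K ∪ {ξ, Z, v}) ∪ {s}) with hT₂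
  have hT₁₂ : T₁ ≤ T₂ := Algebra.adjoin_mono Set.subset_union_left
  have hsT₂ : s ∈ T₂ := Algebra.subset_adjoin (Or.inr rfl)
  have hT₂B : T₂ ≤ B := by
    refine Algebra.adjoin_le (Set.union_subset (fun a ha => hT₁B (Algebra.subset_adjoin ha)) ?_)
    rintro a rfl
    exact hsB
  have hwT₂ : w ∈ T₂ := by
    rw [hws]
    exact T₂.add_mem (hT₁₂ hωT₁) (T₂.mul_mem (T₂.pow_mem (hT₁₂ hξT₁) _) hsT₂)
  have hzT₂ : z ∈ T₂ := by
    rw [show z = Z - ξ * w by rw [hZ]; ring]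
    exact T₂.sub_mem (hT₁₂ hZT₁) (T₂.mul_mem (hT₁₂ hξT₁) hwT₂)
  have hyT₂ : y ∈ T₂ := by
    rw [show y = c⁻¹ * (s * G - f) by rw [hGs]; field_simp; ring]
    exact T₂.mul_mem (hT₁₂ (hiT₁ c hcP)) (T₂.sub_mem (T₂.mul_mem hsT₂ (T₂.sum_mem fun i _ =>
      T₂.mul_mem (T₂.pow_mem (T₂.sub_mem (hT₁₂ hZT₁) (T₂.mul_mem (hT₁₂ hξT₁) (hT₁₂ hωT₁))) _)
        (T₂.pow_mem hzT₂ _))) (hT₁₂ hfT₁))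
  have hST₂ : S ≤ T₂ := by
    rw [hS]
    refine Algebra.adjoin_le (Set.union_subset (fun a ha => hT₁₂ (hPT₁ ha)) ?_)
    rintro a (rfl | rfl | rfl | rfl)
    exacts [hT₁₂ hξT₁, hyT₂, hzT₂, hwT₂]
  -- `Δ` kills `T₁`, so `Δ s = ξ ^ (1 - n)`
  have hΔZ : Δ Z = 0 := by
    rw [hZ, map_add, Δ.leibniz, hΔz, hΔξ, hΔw]
    simp
  have hinv : ∀ D : Derivation k L L, (∀ p ∈ P, D p = 0) → ∀ a ∈ K, D a = 0 := by
    rintro D hD a (ha | ha)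
    · exact hD a ha
    · rw [← inv_inv a, D.leibniz_inv, hD _ ha, smul_zero]
  have hDv : ∀ D : Derivation k L L, (∀ p ∈ P, D p = 0) →
      ξ * D v = -(v * D ξ) - q * Z ^ (q - 1) * D Z := by
    intro D hD
    have h1 := congrArg D hv
    simp only [map_add, D.leibniz, D.leibniz_pow, hD τ hτP, map_zero, smul_eq_mul,
      nsmul_eq_mul] at h1
    linear_combination h1
  have hΔv : Δ v = 0 := by
    have := hDv Δ hΔP
    rw [hΔξ, hΔZ] at this
    simpa [hξ] using this
  have hΔT₁ : ∀ a ∈ T₁, Δ a = 0 := by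
    intro a ha
    refine Derivation.eqOn_adjoin (D1 := Δ) (D2 := 0) ?_ ha
    rintro x (hx | rfl | rfl | rfl)
    exacts [hinv Δ hΔP x hx, hΔξ, hΔZ, hΔv]
  have hΔs : Δ s ≠ 0 := by
    have := congrArg Δ hws
    rw [hΔw, map_add, hΔT₁ ω hωT₁, Δ.leibniz, hΔT₁ _ (T₁.pow_mem hξT₁ _), smul_zero, add_zero,
      zero_add] at this
    intro h0
    rw [h0, smul_zero] at this
    exact one_ne_zero this
  -- the multiple of `Δ` is chosen so that `E` kills the slice `s`
  set b := -(E₀ s / Δ s) with hb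
  set E := E₀ + b • Δ with hE
  have hEs : E s = 0 := by
    rw [hE, Derivation.add_apply, Derivation.smul_apply, hb, smul_eq_mul]
    field_simp
    ring
  have hEP : ∀ p ∈ P, E p = 0 := fun p hp => by
    rw [hE, Derivation.add_apply, Derivation.smul_apply, hE₀P p hp, hΔP p hp, smul_zero, add_zero]
  have hEξ : E ξ = -(q * Z ^ (q - 1)) := by
    rw [hE, Derivation.add_apply, Derivation.smul_apply, hE₀ξ, hΔξ, smul_zero, add_zero]
  have hEZ : E Z = v := by
    rw [hE, Derivation.add_apply, Derivation.smul_apply, hE₀Z, hΔZ, smul_zero, add_zero]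
  have hEv : E v = 0 := by
    have := hDv E hEP
    rw [hEξ, hEZ] at this
    refine mul_left_cancel₀ hξ ?_
    linear_combination this
  have hET₂ : ∀ a ∈ T₂, E a ∈ T₂ := by
    intro a ha
    refine derivation_mapsTo_adjoin le_rfl ?_ ha
    rintro x ((hx | rfl | rfl | rfl) | rfl)
    · rw [hinv E hEP x hx]; exact T₂.zero_mem
    · rw [hEξ, ← map_natCast (algebraMap k L)]
      exact T₂.neg_mem (T₂.mul_mem (T₂.algebraMap_mem _) (T₂.pow_mem (hT₁₂ hZT₁) _))
    · rw [hEZ]; exact hT₁₂ hvT₁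
    · rw [hEv]; exact T₂.zero_mem
    · rw [hEs]; exact T₂.zero_mem
  have hnil : T₂ ≤ nilSubalgebra E := by
    have hZn : Z ∈ nilSubalgebra E := mem_nilSubalgebra_of_apply_mem (by
      rw [hEZ]; exact mem_nilSubalgebra_of_apply_eq_zero hEv)
    refine Algebra.adjoin_le ?_
    rintro x ((hx | rfl | rfl | rfl) | rfl)
    · exact mem_nilSubalgebra_of_apply_eq_zero (hinv E hEP x hx)
    · refine mem_nilSubalgebra_of_apply_mem ?_
      rw [hEξ, ← map_natCast (algebraMap k L)]
      exact Subalgebra.neg_mem _ (Subalgebra.mul_mem _ (Subalgebra.algebraMap_mem _ _)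
        (Subalgebra.pow_mem _ hZn _))
    · exact hZn
    · exact mem_nilSubalgebra_of_apply_eq_zero hEv
    · exact mem_nilSubalgebra_of_apply_eq_zero hEs
  -- `E` maps `S` into its localization; take a common denominator over the four generators
  have hden : ∀ a ∈ S, ∃ g ∈ P, g ≠ 0 ∧ g * E a ∈ S := fun a ha => hT₂B (hET₂ a (hST₂ ha))
  obtain ⟨g₁, hg₁, hg₁0, h₁⟩ := hden ξ hξS
  obtain ⟨g₂, hg₂, hg₂0, h₂⟩ := hden y hyS
  obtain ⟨g₃, hg₃, hg₃0, h₃⟩ := hden z hzS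
  obtain ⟨g₄, hg₄, hg₄0, h₄⟩ := hden w hwS
  have hgP : g₁ * g₂ * g₃ * g₄ ∈ P := P.mul_mem (P.mul_mem (P.mul_mem hg₁ hg₂) hg₃) hg₄
  refine ⟨b, g₁ * g₂ * g₃ * g₄, by simp [hg₁0, hg₂0, hg₃0, hg₄0], fun a ha => ⟨?_, ?_⟩⟩
  · refine derivation_mapsTo_adjoin (s := (P : Set L) ∪ {ξ, y, z, w}) hS.ge ?_ (hS ▸ ha)
    rintro x (hx | rfl | rfl | rfl | rfl)
    · rw [Derivation.smul_apply, hEP x hx, smul_zero]; exact S.zero_mem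
    · rw [Derivation.smul_apply, smul_eq_mul, show g₁ * g₂ * g₃ * g₄ * E x =
        g₂ * g₃ * g₄ * (g₁ * E x) by ring]
      exact S.mul_mem (hPS (P.mul_mem (P.mul_mem hg₂ hg₃) hg₄)) h₁
    · rw [Derivation.smul_apply, smul_eq_mul, show g₁ * g₂ * g₃ * g₄ * E x =
        g₁ * g₃ * g₄ * (g₂ * E x) by ring]
      exact S.mul_mem (hPS (P.mul_mem (P.mul_mem hg₁ hg₃) hg₄)) h₂
    · rw [Derivation.smul_apply, smul_eq_mul, show g₁ * g₂ * g₃ * g₄ * E x =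
        g₁ * g₂ * g₄ * (g₃ * E x) by ring]
      exact S.mul_mem (hPS (P.mul_mem (P.mul_mem hg₁ hg₂) hg₄)) h₃
    · rw [Derivation.smul_apply, smul_eq_mul, show g₁ * g₂ * g₃ * g₄ * E x =
        g₁ * g₂ * g₃ * (g₄ * E x) by ring]
      exact S.mul_mem (hPS (P.mul_mem (P.mul_mem hg₁ hg₂) hg₃)) h₄
  · obtain ⟨N, hN⟩ := hnil (hST₂ ha)
    exact ⟨N, by rw [iterate_smul_apply (hEP _ hgP), hN, mul_zero]⟩

/-! ### Constructions of derivations -/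

section
variable {k A : Type*} [CommRing k] [CommRing A] [Algebra k A]

theorem isLocallyNilpotentDerivation_of_adjoin_eq_top {D : Derivation k A A} {s : Set A}
    (hs : Algebra.adjoin k s = ⊤) (h : s ⊆ nilSubalgebra D) :
    IsLocallyNilpotentDerivation D := fun _ =>
  (Algebra.adjoin_le h : Algebra.adjoin k s ≤ nilSubalgebra D) (hs ▸ Algebra.mem_top)

theorem mem_makarLimanov {a : A} : a ∈ makarLimanov k A ↔
    ∀ D : Derivation k A A, IsLocallyNilpotentDerivation D → D a = 0 := by
  simp only [makarLimanov, Algebra.mem_iInf]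
  rfl

theorem derivationKer_le_derksen {D : Derivation k A A} (hD : IsLocallyNilpotentDerivation D)
    (hD0 : D ≠ 0) {a : A} (ha : D a = 0) : a ∈ derksen k A :=
  Algebra.subset_adjoin ⟨D, hD, hD0, ha⟩

/-- The extension of a derivation of `A` to `A[X]` acting on coefficients. -/
noncomputable def Derivation.polynomial (D : Derivation k A A) :
    Derivation k (Polynomial A) (Polynomial A) :=
  PolynomialModule.equivPolynomialSelf.compDer D.mapCoeffs

theorem Derivation.coeff_polynomial (D : Derivation k A A) (f : Polynomial A) (i : ℕ) :
    (D.polynomial f).coeff i = D (f.coeff i) := rfl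

theorem Derivation.polynomial_C (D : Derivation k A A) (a : A) :
    D.polynomial (Polynomial.C a) = Polynomial.C (D a) := by
  ext i
  rw [D.coeff_polynomial, Polynomial.coeff_C, Polynomial.coeff_C]
  split_ifs <;> simp

theorem Derivation.polynomial_X (D : Derivation k A A) :
    D.polynomial Polynomial.X = 0 := by
  ext i
  rw [D.coeff_polynomial, Polynomial.coeff_X]
  split_ifs <;> simp

theorem Derivation.iterate_polynomial (D : Derivation k A A) (N : ℕ) (f : Polynomial A) (i : ℕ) :
    (D.polynomial^[N] f).coeff i = D^[N] (f.coeff i) := by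
  induction N generalizing f with
  | zero => rfl
  | succ N ih => rw [Function.iterate_succ_apply, ih, Function.iterate_succ_apply]; rfl

theorem IsLocallyNilpotentDerivation.polynomial {D : Derivation k A A}
    (hD : IsLocallyNilpotentDerivation D) : IsLocallyNilpotentDerivation D.polynomial := by
  intro f
  suffices h : f ∈ nilSubalgebra D.polynomial from h
  induction f using Polynomial.induction_on' with
  | add p q hp hq => exact Subalgebra.add_mem _ hp hq
  | monomial n a =>
    obtain ⟨N, hN⟩ := hD a
    refine ⟨N, ?_⟩
    ext i
    rw [D.iterate_polynomial, Polynomial.coeff_monomial, Polynomial.coeff_zero]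
    split_ifs
    exacts [hN, iterate_map_zero D N]

theorem isLocallyNilpotentDerivation_derivative : IsLocallyNilpotentDerivation
    ((Polynomial.derivative' : Derivation A (Polynomial A) (Polynomial A)).restrictScalars k) :=
  fun f => ⟨f.natDegree + 1, Polynomial.iterate_derivative_eq_zero (Nat.lt_succ_self _)⟩

/-- A derivation of a domain extends to its fraction field, because localizations are formally
étale. -/
theorem Derivation.exists_extend_fractionRing {L : Type*} [IsDomain A] [Field L] [Algebra A L]
    [Algebra k L] [IsScalarTower k A L] [IsFractionRing A L] (D : Derivation k A A) :
    ∃ D' : Derivation k L L, ∀ a, D' (algebraMap A L a) = algebraMap A L (D a) := by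
  have : Algebra.FormallyEtale A L := Algebra.FormallyEtale.of_isLocalization (nonZeroDivisors A)
  let d : Derivation k A L := (Algebra.linearMap A L).compDer D
  let l : TensorProduct A L (Ω[A⁄k]) →ₗ[L] L := LinearMap.liftBaseChange L d.liftKaehlerDifferential
  let e := (KaehlerDifferential.tensorKaehlerEquivOfFormallyEtale k A L).symm
  refine ⟨(l ∘ₗ e.toLinearMap).compDer (KaehlerDifferential.D k L), fun a => ?_⟩
  simp only [Derivation.coe_comp, LinearMap.coe_comp, Function.comp_apply,
    Derivation.coeFn_coe, LinearEquiv.coe_coe, LinearMap.coe_restrictScalars, e]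
  rw [KaehlerDifferential.tensorKaehlerEquivOfFormallyEtale_symm_D_algebraMap]
  simp [l, d]

theorem Derivation.exists_restrict {L : Type*} [Field L] [Algebra A L] [Algebra k L]
    [IsScalarTower k A L] (hinj : Function.Injective (algebraMap A L)) (D : Derivation k L L)
    (hD : ∀ a, D (algebraMap A L a) ∈ (algebraMap A L).range) :
    ∃ D' : Derivation k A A, ∀ a, algebraMap A L (D' a) = D (algebraMap A L a) := by
  choose f hf using hD
  refine ⟨Derivation.mk' { toFun := f, map_add' := ?_, map_smul' := ?_ } ?_, hf⟩
  · intro a b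
    apply hinj
    rw [map_add, hf, hf, hf, map_add, map_add]
  · intro c a
    apply hinj
    simp only [RingHom.id_apply, Algebra.smul_def, map_mul, hf, ← IsScalarTower.algebraMap_apply]
    rw [← Algebra.smul_def, D.map_smul, Algebra.smul_def]
  · intro a b
    apply hinj
    simp [hf, D.leibniz]

theorem IsLocallyNilpotentDerivation.of_algebraMap {L : Type*} [Field L] [Algebra A L]
    [Algebra k L] (hinj : Function.Injective (algebraMap A L)) {D : Derivation k L L}
    {D' : Derivation k A A} (h : ∀ a, algebraMap A L (D' a) = D (algebraMap A L a))
    (hD : ∀ a, ∃ N : ℕ, D^[N] (algebraMap A L a) = 0) : IsLocallyNilpotentDerivation D' := by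
  intro a
  obtain ⟨N, hN⟩ := hD a
  refine ⟨N, hinj ?_⟩
  rw [map_zero, ← hN]
  exact Function.Semiconj.iterate_right (f := algebraMap A L) (fun a => h a) N a

end

/-! ### Polynomial rings and hypersurfaces -/

section
variable {k σ : Type*} [Field k]
open MvPolynomial

theorem mk_jacobian_eq_zero (F : MvPolynomial σ k) (i v : σ) (x : MvPolynomial σ k)
    (hx : Ideal.Quotient.mkₐ k (Ideal.span {F}) x = 0) :
    Ideal.Quotient.mkₐ k (Ideal.span {F}) ((pderiv i F • pderiv v - pderiv v F • pderiv i :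
      Derivation k (MvPolynomial σ k) (MvPolynomial σ k)) x) = 0 := by
  rw [Ideal.Quotient.mkₐ_eq_mk, Ideal.Quotient.eq_zero_iff_mem, Ideal.mem_span_singleton] at *
  obtain ⟨q, rfl⟩ := hx
  refine ⟨pderiv i F * pderiv v q - pderiv v F * pderiv i q, ?_⟩
  simp only [Derivation.sub_apply, Derivation.smul_apply, Derivation.leibniz, smul_eq_mul]
  ring

/-- The derivation of the hypersurface algebra `k[X] / (F)` induced by the Jacobian derivation
`(∂F/∂X_i) ∂/∂X_v - (∂F/∂X_v) ∂/∂X_i`. -/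
noncomputable def jacobianDerivation (F : MvPolynomial σ k) (i v : σ) :
    Derivation k (MvPolynomial σ k ⧸ Ideal.span {F}) (MvPolynomial σ k ⧸ Ideal.span {F}) :=
  Derivation.liftOfSurjective (Ideal.Quotient.mkₐ_surjective k _) (mk_jacobian_eq_zero F i v)

theorem jacobianDerivation_mk (F : MvPolynomial σ k) (i v : σ) (g : MvPolynomial σ k) :
    jacobianDerivation F i v (Ideal.Quotient.mk _ g) =
      Ideal.Quotient.mk _ (pderiv i F * pderiv v g - pderiv v F * pderiv i g) :=
  Derivation.liftOfSurjective_apply (Ideal.Quotient.mkₐ_surjective k _) (mk_jacobian_eq_zero F i v)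
      g

theorem pderiv_eq_zero_of_mem_supported {s : Set σ} {v : σ} {g : MvPolynomial σ k}
    (hg : g ∈ supported k s) (hv : v ∉ s) : pderiv v g = 0 :=
  pderiv_eq_zero_of_notMem_vars fun h => hv (mem_supported.mp hg h)

theorem pderiv_mem_supported {s : Set σ} {g : MvPolynomial σ k}
    (hg : g ∈ supported k s) (v : σ) : pderiv v g ∈ supported k s := by
  classical
  refine derivation_mapsTo_adjoin (s := X '' s) le_rfl ?_ hg
  rintro _ ⟨u, _, rfl⟩
  rw [pderiv_X]
  by_cases h : v = u
  · subst h; simp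
  · simp [Ne.symm h]

theorem aeval_mem_of_mem {A : Type*} [CommRing A] [Algebra k A] (S : Subalgebra k A) {a : A}
    (ha : a ∈ S) (p : Polynomial k) : Polynomial.aeval a p ∈ S :=
  (Algebra.adjoin_le (Set.singleton_subset_iff.mpr ha) : Algebra.adjoin k {a} ≤ S)
    (Polynomial.aeval_mem_adjoin_singleton k a)

/-- A polynomial whose logarithmic derivatives agree with those of a monomial is a multiple of
that monomial. -/
theorem eq_monomial_of_mul_pderiv_eq [CharZero k] {g : MvPolynomial σ k} {e : σ →₀ ℕ}
    (h : ∀ v, monomial e 1 * pderiv v g = g * pderiv v (monomial e 1)) :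
    g = monomial e (coeff e g) := by
  classical
  have h' : ∀ v, X v * pderiv v g = e v • g := by
    intro v
    refine mul_left_cancel₀ (a := monomial e (1 : k)) (by simp) ?_
    have h1 : X v * pderiv v (monomial e (1 : k)) = e v • monomial e 1 := X_mul_pderiv_monomial
    rw [mul_left_comm, h, mul_left_comm, h1]
    simp only [nsmul_eq_mul]
    ring
  ext d
  rw [coeff_monomial]
  split_ifs with hd
  · rw [hd]
  · by_contra hc
    refine hd (Finsupp.ext fun v => ?_)
    have h1 := congrArg (coeff d) (h' v)
    rw [coeff_X_mul', coeff_smul] at h1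
    split_ifs at h1 with hv
    · have hle : Finsupp.single v 1 ≤ d := by
        rw [Finsupp.single_le_iff]
        exact Nat.one_le_iff_ne_zero.mpr (Finsupp.mem_support_iff.mp hv)
      rw [coeff_pderiv, tsub_add_cancel_of_le hle] at h1
      have h2 : (((d - Finsupp.single v 1 : σ →₀ ℕ) v : ℕ) : k) + 1 = d v := by
        have := Finsupp.single_le_iff.mp hle
        rw [Finsupp.tsub_apply, Finsupp.single_eq_same, Nat.cast_sub this]
        simp
      rw [h2, nsmul_eq_mul, mul_comm] at h1
      exact (Nat.cast_injective (mul_right_cancel₀ hc h1)).symm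
    · rw [Finsupp.notMem_support_iff.mp hv]
      have h2 : (e v : k) = 0 := by
        rw [nsmul_eq_mul] at h1
        exact (mul_eq_zero.mp h1.symm).resolve_right hc
      exact_mod_cast h2

theorem isLocallyNilpotentDerivation_pderiv (i : σ) :
    IsLocallyNilpotentDerivation (pderiv i : Derivation k (MvPolynomial σ k) _) := by
  classical
  refine isLocallyNilpotentDerivation_of_adjoin_eq_top adjoin_range_X ?_
  rintro _ ⟨v, rfl⟩
  refine mem_nilSubalgebra_of_apply_mem (mem_nilSubalgebra_of_apply_eq_zero ?_)
  rw [pderiv_X]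
  by_cases h : i = v
  · subst h; simp
  · simp [Ne.symm h]

theorem pderiv_ne_zero (i : σ) :
    (pderiv i : Derivation k (MvPolynomial σ k) (MvPolynomial σ k)) ≠ 0 := fun h =>
  one_ne_zero (α := MvPolynomial σ k) (by rw [← pderiv_X_self (R := k) i, h]; rfl)

theorem makarLimanov_mvPolynomial [CharZero k] : makarLimanov k (MvPolynomial σ k) = ⊥ := by
  refine eq_bot_iff.mpr fun f hf => ?_
  rw [mem_makarLimanov] at hf
  rw [eq_monomial_of_mul_pderiv_eq (g := f) (e := 0) fun v => by
    rw [hf _ (isLocallyNilpotentDerivation_pderiv v)]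
    simp]
  exact Algebra.mem_bot.mpr ⟨_, rfl⟩

theorem derksen_mvPolynomial [Nontrivial σ] : derksen k (MvPolynomial σ k) = ⊤ := by
  rw [eq_top_iff, ← adjoin_range_X]
  refine Algebra.adjoin_le ?_
  rintro _ ⟨v, rfl⟩
  obtain ⟨u, hu⟩ := exists_ne v
  exact derivationKer_le_derksen (isLocallyNilpotentDerivation_pderiv u) (pderiv_ne_zero u)
    (pderiv_X_of_ne hu.symm)

end

/-! ### The defining equation -/

section
open MvPolynomial

section
variable (k : Type*) [Field k] (q r m : ℕ) (n : Fin (m + 1) → ℕ) (p : Polynomial k)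

/-- The coefficient `∏ x_i ^ n_i` of `y` in the defining equation. -/
noncomputable def krLeading : MvPolynomial (KRVar m) k := ∏ i, X (KRVar.x i) ^ n i

/-- The part `x_0 p(∏ x_i)` of the defining equation. -/
noncomputable def krTail : MvPolynomial (KRVar m) k :=
  X (KRVar.x 0) * Polynomial.aeval (∏ i, X (KRVar.x i)) p

theorem krPoly_eq : krPoly k q r m n p = krLeading k m n * X KRVar.y
    + (X KRVar.z ^ q + X KRVar.t ^ r + krTail k m p) := by
  rw [krPoly, krLeading, krTail]
  ring

theorem krLeading_ne_zero : krLeading k m n ≠ 0 :=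
  Finset.prod_ne_zero_iff.mpr fun _ _ => pow_ne_zero _ (X_ne_zero _)

theorem krLeading_mem_supported : krLeading k m n ∈ supported k (Set.range KRVar.x) :=
  Subalgebra.prod_mem _ fun i _ => Subalgebra.pow_mem _ (X_mem_supported.mpr (Set.mem_range_self i))
      _

theorem krTail_mem_supported : krTail k m p ∈ supported k (Set.range KRVar.x) :=
  Subalgebra.mul_mem _ (X_mem_supported.mpr (Set.mem_range_self 0))
    (aeval_mem_of_mem _ (Subalgebra.prod_mem _ fun i _ => X_mem_supported.mpr (Set.mem_range_self
      i)) p)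

theorem range_x_subset_compl_y : Set.range (KRVar.x (m := m)) ⊆ {KRVar.y}ᶜ := by
  rintro _ ⟨i, rfl⟩
  simp

theorem krRest_mem_supported :
    X KRVar.z ^ q + X KRVar.t ^ r + krTail k m p ∈ supported k ({KRVar.y}ᶜ : Set (KRVar m)) :=
  Subalgebra.add_mem _ (Subalgebra.add_mem _
    (Subalgebra.pow_mem _ (X_mem_supported.mpr (by simp)) _)
    (Subalgebra.pow_mem _ (X_mem_supported.mpr (by simp)) _))
    (supported_mono (range_x_subset_compl_y m) (krTail_mem_supported k m p))

theorem exists_krLeading_eq_monomial : ∃ e, krLeading k m n = monomial e 1 := by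
  refine Finset.prod_induction _ (fun f => ∃ e, f = monomial e (1 : k)) ?_ ⟨0, rfl⟩
    fun i _ => ⟨_, X_pow_eq_monomial⟩
  rintro _ _ ⟨e, rfl⟩ ⟨e', rfl⟩
  exact ⟨e + e', by rw [monomial_mul, one_mul]⟩

theorem pderiv_y_krPoly : pderiv KRVar.y (krPoly k q r m n p) = krLeading k m n := by
  rw [krPoly_eq, map_add, pderiv_mul, pderiv_X_self, pderiv_eq_zero_of_mem_supported
    (krLeading_mem_supported k m n) (by simp), pderiv_eq_zero_of_mem_supported
    (krRest_mem_supported k q r m p) (by simp)]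
  ring

/-- No `x_i` divides the part of the equation without `y`, since that part contains `t ^ r`. -/
theorem isRelPrime_krLeading (hq : q ≠ 0) :
    IsRelPrime (krLeading k m n) (X KRVar.z ^ q + X KRVar.t ^ r + krTail k m p) := by
  refine IsRelPrime.prod_left fun i _ => IsRelPrime.pow_left ?_
  rw [(X_prime (i := KRVar.x i)).irreducible.isRelPrime_iff_not_dvd]
  rintro ⟨g, hg⟩
  classical
  -- evaluation at the point whose only nonzero coordinate is `t = 1`
  let a : KRVar m → k := fun v => if v matches KRVar.t then 1 else 0
  have h := congrArg (aeval a) hg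
  simp [krTail, a, hq] at h

theorem irreducible_krPoly (hq : q ≠ 0) : Irreducible (krPoly k q r m n p) := by
  rw [krPoly_eq]
  refine irreducible_mul_X_add _ _ _ (krLeading_ne_zero k m n) (fun h => ?_) (fun h => ?_)
    (isRelPrime_krLeading k q r m n p hq)
  · exact range_x_subset_compl_y m (mem_supported.mp (krLeading_mem_supported k m n) h) rfl
  · exact mem_supported.mp (krRest_mem_supported k q r m p) h rfl

theorem isDomain_krAlgebra (hq : q ≠ 0) : IsDomain (KRAlgebra k q r m n p) := by
  have := (Ideal.span_singleton_prime (irreducible_krPoly k q r m n p hq).ne_zero).mpr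
    (irreducible_krPoly k q r m n p hq).prime
  exact Ideal.Quotient.isDomain _

variable {k q r m n p}

/-- The polynomials in the variables other than `y` embed in the quotient: a nonzero multiple of the
defining equation has positive degree in `y`. -/
theorem eq_zero_of_mk_eq_zero {g : MvPolynomial (KRVar m) k} (hg : g ∈ supported k {KRVar.y}ᶜ)
    (h : (Ideal.Quotient.mk _ g : KRAlgebra k q r m n p) = 0) : g = 0 := by
  classical
  rw [Ideal.Quotient.eq_zero_iff_mem, Ideal.mem_span_singleton] at h
  obtain ⟨f, rfl⟩ := h
  by_contra h0
  have h1 := degreeOf_mul_eq (n := KRVar.y) (left_ne_zero_of_mul h0) (right_ne_zero_of_mul h0)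
  have h2 : degreeOf KRVar.y (krPoly k q r m n p * f) = 0 := by
    by_contra hne
    exact mem_supported.mp hg (mem_vars_iff_degreeOf_ne_zero.mpr hne) rfl
  have h3 : degreeOf KRVar.y (krPoly k q r m n p) ≠ 0 := by
    intro h3
    refine krLeading_ne_zero k m n ?_
    rw [← pderiv_y_krPoly k q r m n p]
    exact pderiv_eq_zero_of_notMem_vars fun hv => mem_vars_iff_degreeOf_ne_zero.mp hv h3
  omega

/-- After inverting the `x_i`, the variable `y` can be eliminated. -/
theorem exists_krLeading_pow_mul_eq_mk (a : KRAlgebra k q r m n p) :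
    ∃ N : ℕ, ∃ g ∈ supported k ({KRVar.y}ᶜ : Set (KRVar m)),
      Ideal.Quotient.mk _ (krLeading k m n ^ N) * a = Ideal.Quotient.mk _ g := by
  have hπ := supported_mono (R := k) (range_x_subset_compl_y m) (krLeading_mem_supported k m n)
  obtain ⟨f, rfl⟩ := Ideal.Quotient.mk_surjective a
  induction f using MvPolynomial.induction_on with
  | C c => exact ⟨0, C c, Subalgebra.algebraMap_mem _ c, by simp⟩
  | add f g hf hg =>
    obtain ⟨N, f', hf', hf⟩ := hf
    obtain ⟨M, g', hg', hg⟩ := hg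
    refine ⟨N + M, krLeading k m n ^ M * f' + krLeading k m n ^ N * g', Subalgebra.add_mem _
      (Subalgebra.mul_mem _ (Subalgebra.pow_mem _ hπ _) hf')
      (Subalgebra.mul_mem _ (Subalgebra.pow_mem _ hπ _) hg'), ?_⟩
    simp only [map_add, map_mul, map_pow, ← hf, ← hg]
    ring
  | mul_X f v hf =>
    obtain ⟨N, f', hf', hf⟩ := hf
    by_cases hv : v = KRVar.y
    · subst hv
      refine ⟨N + 1, -(f' * (X KRVar.z ^ q + X KRVar.t ^ r + krTail k m p)), Subalgebra.neg_mem _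
        (Subalgebra.mul_mem _ hf' (krRest_mem_supported k q r m p)), ?_⟩
      have h0 : (Ideal.Quotient.mk _ (krPoly k q r m n p) : KRAlgebra k q r m n p) = 0 :=
        Ideal.Quotient.eq_zero_iff_mem.mpr (Ideal.mem_span_singleton_self _)
      rw [congrArg (Ideal.Quotient.mk _) (krPoly_eq k q r m n p), map_add, map_mul] at h0
      rw [map_neg, map_mul _ f', ← hf, map_mul _ f, map_pow, map_pow]
      linear_combination (Ideal.Quotient.mk _ (krLeading k m n)) ^ N * Ideal.Quotient.mk _ f * h0
    · refine ⟨N, f' * X v, Subalgebra.mul_mem _ hf' (X_mem_supported.mpr hv), ?_⟩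
      rw [map_mul, map_mul, ← hf]
      ring

theorem isLocallyNilpotentDerivation_jacobianDerivation {v : KRVar m}
    (hv : v = KRVar.z ∨ v = KRVar.t) :
    IsLocallyNilpotentDerivation (jacobianDerivation (krPoly k q r m n p) KRVar.y v) := by
  classical
  set D := jacobianDerivation (krPoly k q r m n p) KRVar.y v
  have hvx : v ∉ Set.range (KRVar.x (m := m)) := by
    rintro ⟨i, rfl⟩
    simp at hv
  have hvy : KRVar.y ≠ v := by
    rintro rfl
    simp at hv
  have hsupp : ∀ g ∈ supported k (Set.range (KRVar.x (m := m))),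
      D (Ideal.Quotient.mk _ g) = 0 := fun g hg => by
    rw [jacobianDerivation_mk, pderiv_eq_zero_of_mem_supported hg hvx,
      pderiv_eq_zero_of_mem_supported hg (by simp)]
    simp
  have hv_mem : Ideal.Quotient.mk _ (X v) ∈ nilSubalgebra D := by
    refine mem_nilSubalgebra_of_apply_mem (mem_nilSubalgebra_of_apply_eq_zero ?_)
    rw [jacobianDerivation_mk, pderiv_X_self, pderiv_X_of_ne hvy.symm, mul_one, mul_zero, sub_zero,
      pderiv_y_krPoly]
    exact hsupp _ (krLeading_mem_supported k m n)
  refine isLocallyNilpotentDerivation_of_adjoin_eq_top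
    (s := Ideal.Quotient.mkₐ k _ '' Set.range X) ?_ ?_
  · rw [Algebra.adjoin_image, adjoin_range_X, Algebra.map_top]
    exact AlgHom.range_eq_top _ |>.mpr (Ideal.Quotient.mkₐ_surjective k _)
  rintro _ ⟨_, ⟨u, rfl⟩, rfl⟩
  rw [Ideal.Quotient.mkₐ_eq_mk]
  by_cases huv : u = v
  · rw [huv]; exact hv_mem
  by_cases huy : u = KRVar.y
  · refine mem_nilSubalgebra_of_apply_mem ?_
    rw [huy, jacobianDerivation_mk, pderiv_X_self, pderiv_X_of_ne hvy, mul_zero, zero_sub, mul_one,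
      map_neg]
    refine Subalgebra.neg_mem _ ?_
    have hF : pderiv v (krPoly k q r m n p) =
        (q : MvPolynomial (KRVar m) k) * X KRVar.z ^ (q - 1) * pderiv v (X KRVar.z) +
          (r : MvPolynomial (KRVar m) k) * X KRVar.t ^ (r - 1) * pderiv v (X KRVar.t) := by
      rw [krPoly_eq, map_add, pderiv_mul, pderiv_X_of_ne hvy, pderiv_eq_zero_of_mem_supported
        (krLeading_mem_supported k m n) hvx, map_add, map_add, pderiv_eq_zero_of_mem_supported
        (krTail_mem_supported k m p) hvx, pderiv_pow, pderiv_pow]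
      ring
    rw [hF]
    rcases hv with rfl | rfl
    · rw [pderiv_X_self, pderiv_X_of_ne (by simp)]
      simp only [mul_zero, add_zero, mul_one, map_mul, map_natCast, map_pow]
      exact Subalgebra.mul_mem _ (Subalgebra.natCast_mem _ _) (Subalgebra.pow_mem _ hv_mem _)
    · rw [pderiv_X_self, pderiv_X_of_ne (by simp)]
      simp only [mul_zero, zero_add, mul_one, map_mul, map_natCast, map_pow]
      exact Subalgebra.mul_mem _ (Subalgebra.natCast_mem _ _) (Subalgebra.pow_mem _ hv_mem _)
  · refine mem_nilSubalgebra_of_apply_eq_zero ?_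
    rw [jacobianDerivation_mk, pderiv_X_of_ne huv, pderiv_X_of_ne huy]
    simp

theorem jacobianDerivation_mk_of_mem_supported {g : MvPolynomial (KRVar m) k}
    (hg : g ∈ supported k {KRVar.y}ᶜ) (v : KRVar m) :
    jacobianDerivation (krPoly k q r m n p) KRVar.y v (Ideal.Quotient.mk _ g) =
      Ideal.Quotient.mk _ (krLeading k m n) * Ideal.Quotient.mk _ (pderiv v g) := by
  rw [jacobianDerivation_mk, pderiv_eq_zero_of_mem_supported (v := KRVar.y) hg (by simp), mul_zero,
    sub_zero, pderiv_y_krPoly, map_mul]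

end
end

/-! ### Locally nilpotent derivations moving a single `x_i` -/

section
open MvPolynomial
variable {k : Type*} [Field k] {q r m : ℕ} {n : Fin (m + 1) → ℕ} {p : Polynomial k}

/-- The expansion of `t ^ r + x_0 p(∏ x_j)` in powers of `x_i` has a nonzero constant term `τ`: it
is `t ^ r` if `i = 0`, and `t ^ r + p(0) x_0` otherwise. -/
theorem exists_krTail_eq (r : ℕ) (p : Polynomial k) (i : Fin (m + 1)) :
    ∃ τ ∈ supported k ({v | ∃ j, j ≠ i ∧ v = KRVar.x j} ∪ {KRVar.t} : Set (KRVar m)),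
      τ ≠ 0 ∧ ∃ h ∈ supported k (insert (KRVar.x i)
        ({v | ∃ j, j ≠ i ∧ v = KRVar.x j} ∪ {KRVar.t} : Set (KRVar m))),
      X KRVar.t ^ r + krTail k m p = τ + X (KRVar.x i) * h := by
  classical
  have ht : (X KRVar.t : MvPolynomial (KRVar m) k) ∈
      supported k ({v | ∃ j, j ≠ i ∧ v = KRVar.x j} ∪ {KRVar.t} : Set (KRVar m)) :=
    X_mem_supported.mpr (by simp)
  have hx : ∀ j, (X (KRVar.x j) : MvPolynomial (KRVar m) k) ∈ supported k (insert (KRVar.x i)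
      ({v | ∃ j, j ≠ i ∧ v = KRVar.x j} ∪ {KRVar.t} : Set (KRVar m))) := fun j =>
    X_mem_supported.mpr (by
      by_cases h : j = i
      · simp [h]
      · simp [h])
  have hprod : ∀ s : Finset (Fin (m + 1)), (∏ j ∈ s, X (KRVar.x j) : MvPolynomial (KRVar m) k) ∈
      supported k (insert (KRVar.x i)
      ({v | ∃ j, j ≠ i ∧ v = KRVar.x j} ∪ {KRVar.t} : Set (KRVar m))) := fun s =>
    Subalgebra.prod_mem _ fun j _ => hx j
  by_cases hi : i = 0
  · subst hi
    exact ⟨X KRVar.t ^ r, Subalgebra.pow_mem _ ht _, pow_ne_zero _ (X_ne_zero _),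
      Polynomial.aeval (∏ i, X (KRVar.x i)) p, aeval_mem_of_mem _ (hprod _) p, rfl⟩
  · refine ⟨X KRVar.t ^ r + X (KRVar.x 0) * C (p.coeff 0), Subalgebra.add_mem _
      (Subalgebra.pow_mem _ ht _) (Subalgebra.mul_mem _ (X_mem_supported.mpr ?_)
        (Subalgebra.algebraMap_mem _ _)), fun h0 => ?_,
      X (KRVar.x 0) * (∏ j ∈ Finset.univ.erase i, X (KRVar.x j)) *
        Polynomial.aeval (∏ i, X (KRVar.x i)) p.divX, Subalgebra.mul_mem _ (Subalgebra.mul_mem _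
          (hx 0) (hprod _)) (aeval_mem_of_mem _ (hprod _) _), ?_⟩
    · exact Or.inl ⟨0, Ne.symm hi, rfl⟩
    -- evaluation at the point whose only nonzero coordinate is `t = 1`
    · let a : KRVar m → k := fun v => if v matches KRVar.t then 1 else 0
      have := congrArg (aeval a) h0
      simp [a] at this
    · have h1 := congrArg (Polynomial.aeval (∏ i, X (KRVar.x i) : MvPolynomial (KRVar m) k))
        p.divX_mul_X_add
      rw [map_add, map_mul, Polynomial.aeval_X, Polynomial.aeval_C] at h1
      rw [krTail, ← h1, ← Finset.mul_prod_erase Finset.univ _ (Finset.mem_univ i), algebraMap_eq]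
      ring

/-- The lifting result for `S = R[w]` inside its fraction field `L`. The algebra `R` is given by a
presentation `f` and the properties of the quotient by `krPoly` that matter, together with the
Jacobian derivations `hD`. -/
theorem exists_locallyNilpotent_of_surjective [CharZero k] {R : Type*} [CommRing R] [IsDomain R]
    [Algebra k R] (L : Type*) [Field L] [Algebra (Polynomial R) L]
    [IsFractionRing (Polynomial R) L] [Algebra k L] [IsScalarTower k (Polynomial R) L]
    (f : MvPolynomial (KRVar m) k →ₐ[k] R) (hf : Function.Surjective f)
    (hf0 : ∀ g ∈ supported k ({KRVar.y}ᶜ : Set (KRVar m)), f g = 0 → g = 0)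
    (hF : f (krPoly k q r m n p) = 0)
    (hD : ∀ v, ∃ D : Derivation k R R, ∀ g ∈ supported k ({KRVar.y}ᶜ : Set (KRVar m)),
      D (f g) = f (krLeading k m n) * f (pderiv v g))
    (hq : q ≠ 0) (hn : ∀ i, n i ≠ 0) (i : Fin (m + 1)) :
    ∃ E : Derivation k (Polynomial R) (Polynomial R),
      IsLocallyNilpotentDerivation (k := k) (A := Polynomial R) E ∧
        ∃ α, α ≠ 0 ∧ ∀ g ∈ supported k (Set.range KRVar.x),
          E (Polynomial.C (f g)) = α * Polynomial.C (f (pderiv (KRVar.x i) g)) := by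
  classical
  let ι : Polynomial R →ₐ[k] L := IsScalarTower.toAlgHom k (Polynomial R) L
  have hι : Function.Injective ι := IsFractionRing.injective (Polynomial R) L
  have : CharZero L := charZero_of_injective_algebraMap (algebraMap k L).injective
  let φ : MvPolynomial (KRVar m) k →ₐ[k] L := (ι.comp Polynomial.CAlgHom).comp f
  have hφ : ∀ g, φ g = ι (Polynomial.C (f g)) := fun g => rfl
  have hφ0 : ∀ g ∈ supported k ({KRVar.y}ᶜ : Set (KRVar m)), φ g = 0 → g = 0 := by
    intro g hg h
    refine hf0 g hg ?_
    exact Polynomial.C_injective (hι (by rw [map_zero, map_zero]; exact h))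
  -- the Jacobian derivations of `R`, extended to `L` with `w ↦ 0`
  have hext : ∀ v, ∃ D : Derivation k L L, (∀ g ∈ supported k ({KRVar.y}ᶜ : Set (KRVar m)),
      D (φ g) = φ (krLeading k m n) * φ (pderiv v g)) ∧
      D (ι Polynomial.X) = 0 := by
    intro v
    obtain ⟨D₀, hD₀⟩ := hD v
    obtain ⟨D, hD'⟩ := Derivation.exists_extend_fractionRing (L := L) D₀.polynomial
    have hD : ∀ f, D (ι f) = ι (D₀.polynomial f) := hD'
    refine ⟨D, fun g hg => ?_, ?_⟩
    · rw [hφ, hD, Derivation.polynomial_C, hD₀ g hg, map_mul, map_mul]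
      rfl
    · rw [hD, Derivation.polynomial_X, map_zero]
  obtain ⟨Dx, hDx, hDxw⟩ := hext (KRVar.x i)
  obtain ⟨Dz, hDz, hDzw⟩ := hext KRVar.z
  obtain ⟨Dw, hDw'⟩ := Derivation.exists_extend_fractionRing (k := k)
      (A := Polynomial R) (L := L)
      ((Polynomial.derivative' : Derivation R
        (Polynomial R) (Polynomial R)).restrictScalars k)
  have hDw : ∀ f, Dw (ι f) = ι (Polynomial.derivative f) := hDw'
  have hDwφ : ∀ g, Dw (φ g) = 0 := fun g => by
    rw [hφ, hDw]
    simp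
  set w : L := ι Polynomial.X with hw
  have hDww : Dw w = 1 := by
    rw [hw, hDw]
    simp
  set ξ : L := φ (X (KRVar.x i)) with hξ
  set z : L := φ (X KRVar.z) with hz
  set π : L := φ (krLeading k m n) with hπ
  have hsub : Set.range (KRVar.x (m := m)) ⊆ {KRVar.y}ᶜ := range_x_subset_compl_y m
  have hπ0 : π ≠ 0 := fun h => krLeading_ne_zero k m n
    (hφ0 _ (supported_mono hsub (krLeading_mem_supported k m n)) h)
  have hξmem : (X (KRVar.x i) : MvPolynomial (KRVar m) k) ∈ supported k {KRVar.y}ᶜ :=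
    X_mem_supported.mpr (by simp)
  have hzmem : (X KRVar.z : MvPolynomial (KRVar m) k) ∈ supported k {KRVar.y}ᶜ :=
    X_mem_supported.mpr (by simp)
  have hξ0 : ξ ≠ 0 := fun h => X_ne_zero _ (hφ0 _ hξmem h)
  obtain ⟨τ, hτ, hτ0, h, hh, htail⟩ := exists_krTail_eq r p i
  set s : Set (KRVar m) := {v | ∃ j, j ≠ i ∧ v = KRVar.x j} ∪ {KRVar.t} with hs
  have hsy : s ⊆ {KRVar.y}ᶜ := by
    rintro v (⟨j, _, rfl⟩ | rfl) <;> simp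
  have hxs : KRVar.x i ∉ s := by
    rintro (⟨j, hj, h⟩ | h)
    · exact hj (KRVar.x.inj h).symm
    · exact absurd h (by simp)
  have hzs : KRVar.z ∉ s := by
    rintro (⟨j, hj, h⟩ | h)
    · exact absurd h (by simp)
    · exact absurd h (by simp)
  set c : MvPolynomial (KRVar m) k := ∏ j ∈ Finset.univ.erase i, X (KRVar.x j) ^ n j with hc
  have hxj : ∀ j, j ≠ i → (X (KRVar.x j) : MvPolynomial (KRVar m) k) ∈ supported k s :=
    fun j hj => X_mem_supported.mpr (Or.inl ⟨j, hj, rfl⟩)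
  have hcs : c ∈ supported k s := Subalgebra.prod_mem _ fun j hj =>
    Subalgebra.pow_mem _ (hxj j (Finset.ne_of_mem_erase hj)) _
  have hlead : krLeading k m n = c * X (KRVar.x i) ^ n i := by
    rw [krLeading, ← Finset.mul_prod_erase Finset.univ _ (Finset.mem_univ i), mul_comm]
  have hc0 : c ≠ 0 := by
    rintro h0
    exact krLeading_ne_zero k m n (by rw [hlead, h0, zero_mul])
  -- `(ξ, Z, v)` satisfies the equation `ξ v + Z ^ q + τ = 0` of the auxiliary hypersurface
  set Z : L := z + ξ * w with hZ
  have hZ0 : Z ≠ 0 := by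
    intro h0
    have h1 : ι (Polynomial.C (f (X KRVar.z)) +
        Polynomial.C (f (X (KRVar.x i))) * Polynomial.X) = ι 0 := by
      rw [map_zero, ← h0, map_add, map_mul]
      rfl
    have h2 := congrArg (fun f => Polynomial.coeff f 0) (hι h1)
    refine X_ne_zero (R := k) KRVar.z (hf0 _ hzmem ?_)
    simpa using h2
  set v : L := -(Z ^ q + φ τ) / ξ with hv
  set a : L := -(q * Z ^ (q - 1)) with ha
  set E₀ : Derivation k L L := (a / π) • Dx + ((v - a * w) / π) • Dz with hE₀
  set Δ : Derivation k L L := Dw - (ξ / π) • Dz with hΔ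
  have hE₀φ : ∀ g ∈ supported k ({KRVar.y}ᶜ : Set (KRVar m)), E₀ (φ g) =
      a * φ (pderiv (KRVar.x i) g) + (v - a * w) * φ (pderiv KRVar.z g) := by
    intro g hg
    rw [hE₀, Derivation.add_apply, Derivation.smul_apply, Derivation.smul_apply, hDx g hg,
      hDz g hg, smul_eq_mul, smul_eq_mul]
    field_simp
  have hΔφ : ∀ g ∈ supported k ({KRVar.y}ᶜ : Set (KRVar m)), Δ (φ g) =
      -(ξ * φ (pderiv KRVar.z g)) := by
    intro g hg
    rw [hΔ, Derivation.sub_apply, Derivation.smul_apply, hDz g hg, hDwφ, smul_eq_mul]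
    field_simp
    ring
  have hE₀ξ : E₀ ξ = a := by
    rw [hξ, hE₀φ _ hξmem, pderiv_X_self, pderiv_X_of_ne (by simp)]
    simp
  have hE₀z : E₀ z = v - a * w := by
    rw [hz, hE₀φ _ hzmem, pderiv_X_self, pderiv_X_of_ne (by simp)]
    simp
  have hE₀w : E₀ w = 0 := by
    rw [hE₀, Derivation.add_apply, Derivation.smul_apply, Derivation.smul_apply, hDxw, hDzw]
    simp
  have hΔξ : Δ ξ = 0 := by
    rw [hξ, hΔφ _ hξmem, pderiv_X_of_ne (by simp)]
    simp
  have hadj : ι.range = Algebra.adjoin k ((((supported k s).map φ : Subalgebra k L) : Set L) ∪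
      {ξ, φ (X KRVar.y), z, w}) := by
    refine le_antisymm ?_ (Algebra.adjoin_le ?_)
    · have h1 : ∀ g, φ g ∈ Algebra.adjoin k
          ((((supported k s).map φ : Subalgebra k L) : Set L) ∪ {ξ, φ (X KRVar.y), z, w}) := by
        intro g
        induction g using MvPolynomial.induction_on with
        | C c => exact (φ.commutes c).symm ▸ Subalgebra.algebraMap_mem _ c
        | add f g hf hg => rw [map_add]; exact Subalgebra.add_mem _ hf hg
        | mul_X f u hf =>
          rw [map_mul]
          refine Subalgebra.mul_mem _ hf (Algebra.subset_adjoin ?_)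
          rcases u with j | _ | _ | _
          · by_cases hj : j = i
            · exact Or.inr (by simp [hj, hξ])
            · exact Or.inl ⟨X (KRVar.x j), hxj j hj, rfl⟩
          · exact Or.inr (by simp)
          · exact Or.inr (by simp [hz])
          · exact Or.inl ⟨X KRVar.t, X_mem_supported.mpr (Or.inr rfl), rfl⟩
      rintro _ ⟨f, rfl⟩
      induction f using Polynomial.induction_on' with
      | add f g hf hg => rw [map_add]; exact Subalgebra.add_mem _ hf hg
      | monomial N a =>
        obtain ⟨g, rfl⟩ := hf a
        rw [← Polynomial.C_mul_X_pow_eq_monomial]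
        change ι _ ∈ _
        rw [map_mul, map_pow]
        refine Subalgebra.mul_mem _ (h1 g) (Subalgebra.pow_mem _ (Algebra.subset_adjoin ?_) _)
        exact Or.inr (by simp [hw, ι])
    · rintro _ (⟨g, _, rfl⟩ | rfl | rfl | rfl | rfl)
      exacts [⟨_, rfl⟩, ⟨_, rfl⟩, ⟨_, rfl⟩, ⟨_, rfl⟩, ⟨_, rfl⟩]
  obtain ⟨b, g, hg, key⟩ := exists_locallyNilpotent_smul_add_smul (S := ι.range)
    (P := (supported k s).map φ) (E₀ := E₀) (Δ := Δ) (ξ := ξ) (y := φ (X KRVar.y)) (z := z)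
    (w := w) (τ := φ τ) (c := φ c) (h := φ h) (v := v) (n := n i) (q := q)
    (by
      rintro _ ⟨g, hg, rfl⟩
      change E₀ (φ g) = 0
      rw [hE₀φ g (supported_mono hsy hg), pderiv_eq_zero_of_mem_supported hg hxs,
        pderiv_eq_zero_of_mem_supported hg hzs]
      simp)
    (by
      rintro _ ⟨g, hg, rfl⟩
      change Δ (φ g) = 0
      rw [hΔφ g (supported_mono hsy hg), pderiv_eq_zero_of_mem_supported hg hzs]
      simp)
    (hn i) hq ⟨τ, hτ, rfl⟩ (fun h0 => hτ0 (hφ0 τ (supported_mono hsy hτ) h0)) ⟨c, hcs, rfl⟩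
    (fun h0 => hc0 (hφ0 c (supported_mono hsy hcs) h0))
    (by
      have h1 : φ h ∈ (supported k (insert (KRVar.x i) s)).map φ := ⟨h, hh, rfl⟩
      rw [supported_eq_adjoin_X, ← Algebra.adjoin_image] at h1
      refine Algebra.adjoin_mono ?_ h1
      rintro _ ⟨_, ⟨u, rfl | hu, rfl⟩, rfl⟩
      · exact Or.inl rfl
      · exact Or.inr ⟨_, X_mem_supported.mpr hu, rfl⟩)
    hξ0 hadj
    (by
      have h0 : φ (krPoly k q r m n p) = 0 := by
        rw [hφ, hF, map_zero, map_zero]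
      rw [krPoly_eq, add_assoc, htail, hlead] at h0
      simp only [map_add, map_mul, map_pow] at h0
      linear_combination h0)
    (by rw [hv]; field_simp; ring)
    hE₀ξ
    (by
      rw [map_add, E₀.leibniz, hE₀z, hE₀w, hE₀ξ, smul_zero, smul_eq_mul]
      ring)
    hΔξ
    (by
      rw [hz, hΔφ _ hzmem, pderiv_X_self, map_one, mul_one])
    (by
      rw [hΔ, Derivation.sub_apply, Derivation.smul_apply, hDzw, hDww, smul_zero, sub_zero])
  obtain ⟨E, hE⟩ : ∃ E : Derivation k (Polynomial R)
      (Polynomial R), ∀ f, ι (E f) = (g • (E₀ + b • Δ)) (ι f) :=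
    Derivation.exists_restrict (k := k) (A := Polynomial R) hι _
      fun a => (key _ ⟨a, rfl⟩).1
  have hEφ : ∀ u ∈ supported k (Set.range (KRVar.x (m := m))),
      ι (E (Polynomial.C (f u))) = g * a * φ (pderiv (KRVar.x i) u) := by
    intro u hu
    rw [hE, ← hφ, Derivation.smul_apply, Derivation.add_apply, Derivation.smul_apply,
      hE₀φ u (supported_mono hsub hu), hΔφ u (supported_mono hsub hu),
      pderiv_eq_zero_of_mem_supported (v := KRVar.z) hu (by simp)]
    simp [mul_assoc]
  have hα := hEφ _ (X_mem_supported.mpr (Set.mem_range_self i))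
  rw [pderiv_X_self, map_one, mul_one] at hα
  refine ⟨E, IsLocallyNilpotentDerivation.of_algebraMap (k := k) (A := Polynomial R) hι hE
    fun a => (key _ ⟨a, rfl⟩).2, E (Polynomial.C (f (X (KRVar.x i)))), fun h0 => ?_,
    fun u hu => hι ?_⟩
  · rw [h0, map_zero] at hα
    refine mul_ne_zero hg ?_ hα.symm
    exact neg_ne_zero.mpr (mul_ne_zero (Nat.cast_ne_zero.mpr hq) (pow_ne_zero _ hZ0))
  · rw [hEφ u hu, map_mul, hα, hφ]

end

/-! ### The invariants of the cylinder -/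

section
open MvPolynomial
variable {k : Type*} [Field k] {q r m : ℕ} {n : Fin (m + 1) → ℕ} {p : Polynomial k}

/-- On `k[x_0, …, x_m]` the derivation is `α ∂/∂x_i` with `α ≠ 0`. -/
theorem exists_locallyNilpotent_x [CharZero k] (hq : q ≠ 0) (hn : ∀ i, n i ≠ 0)
    (i : Fin (m + 1)) :
    ∃ E : Derivation k (Polynomial (KRAlgebra k q r m n p)) (Polynomial (KRAlgebra k q r m n p)),
      IsLocallyNilpotentDerivation (k := k) (A := Polynomial (KRAlgebra k q r m n p)) E ∧
        ∃ α : Polynomial (KRAlgebra k q r m n p), α ≠ 0 ∧ ∀ g ∈ supported k (Set.range KRVar.x),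
          E (Polynomial.C (Ideal.Quotient.mk _ g)) =
            α * Polynomial.C (Ideal.Quotient.mk _ (pderiv (KRVar.x i) g)) := by
  have := isDomain_krAlgebra k q r m n p hq
  exact exists_locallyNilpotent_of_surjective (q := q) (r := r) (n := n) (p := p)
    (FractionRing (Polynomial (KRAlgebra k q r m n p)))
    (Ideal.Quotient.mkₐ k (Ideal.span {krPoly k q r m n p})) (Ideal.Quotient.mkₐ_surjective k _)
    (fun g hg h => eq_zero_of_mk_eq_zero hg h)
    (Ideal.Quotient.eq_zero_iff_mem.mpr (Ideal.mem_span_singleton_self _))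
    (fun v => ⟨_, fun g hg => jacobianDerivation_mk_of_mem_supported hg v⟩) hq hn i

theorem mem_supported_of_pderiv_eq_zero [CharZero k] {σ : Type*} {g : MvPolynomial σ k}
    {s : Set σ} (h : ∀ v ∉ s, pderiv v g = 0) : g ∈ supported k s := by
  classical
  refine mem_supported.mpr fun v hv => ?_
  by_contra hvs
  obtain ⟨d, hd, hdv⟩ := (mem_vars_iff_mem_support v).mp hv
  have hle : Finsupp.single v 1 ≤ d := by
    rw [Finsupp.single_le_iff]
    exact Nat.one_le_iff_ne_zero.mpr (Finsupp.mem_support_iff.mp hdv)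
  have h1 := congrArg (coeff (d - Finsupp.single v 1)) (h v hvs)
  rw [coeff_pderiv, tsub_add_cancel_of_le hle, coeff_zero] at h1
  exact mul_ne_zero (mem_support_iff.mp hd) (Nat.cast_add_one_ne_zero _) h1

theorem makarLimanov_cylinder [CharZero k] (hq : q ≠ 0) (hn : ∀ i, n i ≠ 0) :
    makarLimanov k (Polynomial (KRAlgebra k q r m n p)) = ⊥ := by
  have := isDomain_krAlgebra k q r m n p hq
  have : CharZero (KRAlgebra k q r m n p) :=
    charZero_of_injective_algebraMap (algebraMap k _).injective
  refine eq_bot_iff.mpr fun f hf => ?_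
  rw [mem_makarLimanov] at hf
  obtain ⟨a, rfl⟩ : ∃ a, Polynomial.C a = f := by
    refine ⟨f.coeff 0, (Polynomial.eq_C_of_natDegree_eq_zero ?_).symm⟩
    exact Polynomial.derivative_eq_zero.mp
      (hf _ isLocallyNilpotentDerivation_derivative)
  -- clear the denominators of `a` to get a polynomial `g`, and show that `g` only involves the
  -- `x_i`
  obtain ⟨N, g, hg, hag⟩ := exists_krLeading_pow_mul_eq_mk a
  set h := krLeading k m n ^ N with hh
  have hhx : h ∈ supported k (Set.range KRVar.x) :=
    Subalgebra.pow_mem _ (krLeading_mem_supported k m n) _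
  have hhy : h ∈ supported k {KRVar.y}ᶜ := supported_mono (range_x_subset_compl_y m) hhx
  have hh0 : h ≠ 0 := pow_ne_zero _ (krLeading_ne_zero k m n)
  have hzt : ∀ v, v = KRVar.z ∨ v = KRVar.t → pderiv v g = 0 := by
    intro v hv
    have hD := hf _ (isLocallyNilpotentDerivation_jacobianDerivation hv).polynomial
    rw [Derivation.polynomial_C, Polynomial.C_eq_zero] at hD
    have h1 := congrArg (jacobianDerivation (krPoly k q r m n p) KRVar.y v) hag
    rw [Derivation.leibniz, hD, jacobianDerivation_mk_of_mem_supported hg,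
      jacobianDerivation_mk_of_mem_supported hhy, pderiv_eq_zero_of_mem_supported (v := v) hhx (by
        rintro ⟨i, rfl⟩
        simp at hv), map_zero, mul_zero, smul_zero, smul_zero, add_zero, ← map_mul] at h1
    have h2 := eq_zero_of_mk_eq_zero (Subalgebra.mul_mem _
      (supported_mono (range_x_subset_compl_y m) (krLeading_mem_supported k m n))
      (pderiv_mem_supported hg v)) h1.symm
    exact (mul_eq_zero.mp h2).resolve_left (krLeading_ne_zero k m n)
  have hgy : pderiv KRVar.y g = 0 := pderiv_eq_zero_of_mem_supported hg (by simp)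
  have hgx : g ∈ supported k (Set.range KRVar.x) := by
    refine mem_supported_of_pderiv_eq_zero fun v hv => ?_
    rcases v with i | _ | _ | _
    exacts [absurd ⟨i, rfl⟩ hv, hgy, hzt _ (Or.inl rfl), hzt _ (Or.inr rfl)]
  -- `E a = 0` turns `h a = g` into the equality of logarithmic derivatives of `g` and `h`
  have hpd : ∀ v, h * pderiv v g = g * pderiv v h := by
    intro v
    by_cases hv : v ∈ Set.range KRVar.x
    · obtain ⟨i, rfl⟩ := hv
      obtain ⟨E, hE, α, hα, hEα⟩ := exists_locallyNilpotent_x (r := r) (p := p) hq hn i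
      have h1 := congrArg E (congrArg Polynomial.C hag)
      rw [map_mul, E.leibniz, hf E hE, smul_zero, zero_add, hEα g hgx, hEα h hhx, smul_eq_mul] at h1
      have h2 := mul_left_cancel₀ hα ((mul_left_comm _ _ _).trans h1)
      have h3 := Polynomial.C_injective ((map_mul Polynomial.C _ _).trans h2)
      rw [← sub_eq_zero]
      refine eq_zero_of_mk_eq_zero (q := q) (r := r) (n := n) (p := p) (Subalgebra.sub_mem _
        (Subalgebra.mul_mem _ hhy (pderiv_mem_supported hg _))
        (Subalgebra.mul_mem _ hg (pderiv_mem_supported hhy _))) ?_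
      rw [map_sub, map_mul, map_mul, ← hag, ← h3]
      ring
    · rw [pderiv_eq_zero_of_mem_supported hgx hv, pderiv_eq_zero_of_mem_supported hhx hv, mul_zero,
        mul_zero]
  obtain ⟨e, he⟩ := exists_krLeading_eq_monomial k m n
  have he' : h = monomial (N • e) 1 := by rw [hh, he, monomial_pow, one_pow]
  have hgh : g = C (coeff (N • e) g) * h := by
    rw [he'] at hpd ⊢
    rw [C_mul_monomial, mul_one]
    exact eq_monomial_of_mul_pderiv_eq hpd
  rw [hgh, map_mul, mul_comm] at hag
  have ha := mul_right_cancel₀ (fun h0 => hh0 (eq_zero_of_mk_eq_zero hhy h0)) hag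
  rw [ha]
  exact Algebra.mem_bot.mpr ⟨_, rfl⟩

theorem derksen_cylinder (hq : q ≠ 0) :
    derksen k (Polynomial (KRAlgebra k q r m n p)) = ⊤ := by
  have := isDomain_krAlgebra k q r m n p hq
  have hC : ∀ a, Polynomial.C a ∈ derksen k (Polynomial (KRAlgebra k q r m n p)) := fun a =>
    derivationKer_le_derksen (isLocallyNilpotentDerivation_derivative (k := k)) (fun h0 => by
      have := DFunLike.congr_fun h0 (Polynomial.X : Polynomial (KRAlgebra k q r m n p))
      simp at this) (by simp)
  have hX : Polynomial.X ∈ derksen k (Polynomial (KRAlgebra k q r m n p)) := by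
    refine derivationKer_le_derksen
      (isLocallyNilpotentDerivation_jacobianDerivation (Or.inl rfl)).polynomial (fun h0 => ?_)
      (Derivation.polynomial_X _)
    have h1 := DFunLike.congr_fun h0 (Polynomial.C (Ideal.Quotient.mk _ (X KRVar.z)))
    rw [Derivation.polynomial_C, jacobianDerivation_mk_of_mem_supported
      (X_mem_supported.mpr (by simp)), pderiv_X_self, map_one, mul_one, Derivation.zero_apply,
      Polynomial.C_eq_zero] at h1
    exact krLeading_ne_zero k m n (eq_zero_of_mk_eq_zero
      (supported_mono (range_x_subset_compl_y m) (krLeading_mem_supported k m n)) h1)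
  refine eq_top_iff.mpr fun f _ => ?_
  induction f using Polynomial.induction_on' with
  | add f g hf hg => exact Subalgebra.add_mem _ (hf trivial) (hg trivial)
  | monomial N a =>
    rw [← Polynomial.C_mul_X_pow_eq_monomial]
    exact Subalgebra.mul_mem _ (hC a) (Subalgebra.pow_mem _ hX _)

end

theorem mainTheorem6 {k : Type*} [Field k] [CharZero k] (q r : ℕ) (hq : 2 ≤ q) (hr : 2 ≤ r)
    (hqr : Nat.Coprime q r) (m : ℕ) (n : Fin (m + 1) → ℕ) (hn : ∀ i, 1 < n i)
    (p : Polynomial k) (hp : p.eval 0 ≠ 0) :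
    (makarLimanov k (Polynomial (KRAlgebra k q r m n p)) = ⊥ ∧
      derksen k (Polynomial (KRAlgebra k q r m n p)) = ⊤) ∧
    (makarLimanov k (MvPolynomial (Fin (m + 4)) k) = ⊥ ∧
      derksen k (MvPolynomial (Fin (m + 4)) k) = ⊤) :=
  ⟨⟨makarLimanov_cylinder (by omega) fun i => (by have := hn i; omega),
    derksen_cylinder (by omega)⟩, makarLimanov_mvPolynomial, derksen_mvPolynomial⟩
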